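/- Model. A single-hop beeping network (BL model) consists of $n$ nodes that act in synchronous time slots $0,1,2,\dots$ over one shared channel. In each slot a node beeps, listens, or sleeps; a listening node learns whether at least one node beeps in that slot or none does, and a node that does not listen learns nothing. The nodes are initially indistinguishable and do not know $n$: all of them run the same protocol from the same initial state, and the protocol does not depend on $n$. In every slot a node may toss finitely many fair coins; all tosses, of all nodes in all slots, are independent. Local computation is unrestricted: what a node does in a slot is an arbitrary function of its state and its tosses, and its next state is an arbitrary function of these and of what it heard. A node may halt with a label, which is a natural number; after that it sleeps forever. A node is awake in a slot if it beeps or listens in it. Theorem. There are a protocol, which is the same for all $n$, and constants $C,c>0$ such that for every $n\ge 1$, in the network of $n$ nodes, the following holds with probability at least $1-n^{-c}$: within $C\,n\log n$ time slots all nodes have halted, with pairwise distinct labels in $\{1,\dots,n\}$, and no node has been awake in more than $C\log^2 n$ time slots during the execution. -/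

import Mathlib

open MeasureTheory

namespace Beeping

/-- What a node does with its radio in one time slot. -/
inductive Action where
  | beep
  | listen
  | sleep
  deriving DecidableEq

/-- A randomized algorithm for one node. Local computation is unrestricted. All nodes run the same
protocol from the same initial state; neither an identifier nor the number of nodes is available.
In every time slot the node tosses `coins s` fair coins, where `s` is its current state; the state
and the outcomes of the tosses determine the action taken in the slot; the new state may depend
also on the feedback from the channel. A node halts as soon as `output` of its state is
`some ℓ`, and then `ℓ` is its label. -/
structure Protocol where
  State : Type
  init : State
  coins : State → ℕ
  act : State → List Bool → Action
  next : State → List Bool → Option Bool → State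
  output : State → Option ℕ

/-- The outcomes of all coin tosses: `ω (v, t, i)` is the coin number `i` of node `v` in slot `t`. -/
abbrev Outcome (n : ℕ) : Type := Fin n × ℕ × ℕ → Bool

/-- All coins, of all nodes and all slots, are independent and fair. -/
noncomputable def coinMeasure (n : ℕ) : Measure (Outcome n) :=
  Measure.infinitePi fun _ => (PMF.uniformOfFintype Bool).toMeasure

/-- The feedback to node `v` when the nodes take the actions `a`. A listening node learns whether
at least one node beeps (`some true`) or none does (`some false`); a node that does not listen
learns nothing (`none`). -/
def feedback {n : ℕ} (a : Fin n → Action) (v : Fin n) : Option Bool :=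
  if a v = Action.listen then some (decide (∃ w, a w = Action.beep)) else none

namespace Protocol

variable (P : Protocol) {n : ℕ} (ω : Outcome n)

/-- The coins that node `v` tosses in slot `t` when its state is `s`. -/
def toss (t : ℕ) (v : Fin n) (s : P.State) : List Bool :=
  List.ofFn fun i : Fin (P.coins s) => ω (v, t, i)

/-- The actions in slot `t` when the states are given by `σ`; a node that has halted sleeps. -/
def actions (t : ℕ) (σ : Fin n → P.State) (v : Fin n) : Action :=
  if (P.output (σ v)).isSome then Action.sleep else P.act (σ v) (P.toss ω t v (σ v))

/-- The states after slot `t` when the states before it are `σ`; the state of a node that has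
halted does not change. -/
def step (t : ℕ) (σ : Fin n → P.State) (v : Fin n) : P.State :=
  if (P.output (σ v)).isSome then σ v
  else P.next (σ v) (P.toss ω t v (σ v)) (feedback (P.actions ω t σ) v)

/-- The states of the nodes at the beginning of slot `t` (slots are numbered from `0`). -/
def config : ℕ → Fin n → P.State
  | 0 => fun _ => P.init
  | t + 1 => P.step ω t (config t)

/-- Node `v` is awake (it beeps or listens) in slot `t`. -/
def Awake (v : Fin n) (t : ℕ) : Prop :=
  P.actions ω t (P.config ω t) v ≠ Action.sleep

instance (v : Fin n) : DecidablePred (P.Awake ω v) := fun _ =>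
  inferInstanceAs (Decidable (_ ≠ _))

/-- The number of slots among the first `T` ones in which node `v` is awake. -/
def awakeSlots (T : ℕ) (v : Fin n) : ℕ :=
  ((Finset.range T).filter (P.Awake ω v)).card

/-- After `T` slots all `n` nodes have halted, with pairwise distinct labels in `{1, …, n}`. -/
def NamedBy (T : ℕ) : Prop :=
  ∃ label : Fin n → ℕ,
    (∀ v, P.output (P.config ω T v) = some (label v)) ∧
    (∀ v, label v ∈ Finset.Icc 1 n) ∧
    Function.Injective label

end Protocol

end Beeping

/-!
The protocol has two phases.

*Estimation.* In each of the `16 i` slots of level `i = 1, 2, …` every node beeps with probability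
`2 ^ (-i)` and listens otherwise. Either way it learns whether the slot was silent, so all nodes
stop together at the first level `k` of which at least half of the slots were silent. A slot of
level `i` is silent with probability `(1 - 2 ^ (-i)) ^ n`, and Markov's inequality for an
exponential of the number of such slots gives `n / 8 < 2 ^ k < 32 n` with high probability
(`real_stops_le`, `real_not_stops_le`). This costs `O(k ^ 2)` slots.

*Naming.* Every node draws a random number of `56 k` bits; its residue modulo a power of two of
order `2 ^ k / k` is the node's group. With high probability the numbers are distinct, and every
group is nonempty and has `O(k)` members (`real_not_goodKeys_le`). The groups have consecutive
windows of `O(k ^ 2)` slots. At the beginning of its window a group learns from the previous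
group, bit by bit, how many nodes have been named so far. Then its members repeatedly determine,
bit by bit, the largest key among those not yet named, whose owner takes the next label
(`foldl_rounds`, `foldl_program`). A node is awake in only two windows, hence in `O(k ^ 2)` slots,
and all windows together take `O(2 ^ k k)` slots, which is `O(n log n)`.

After the draw the nodes carry out one common list of instructions in lockstep, so that the naming
phase is a left fold over that list (`config_run`), and its correctness is an invariant of the
fold. For the union bound, all failure events are formulated for fixed levels, independently of
where the estimation stops; they then involve fixed finite sets of coins (`Bad`, `real_bad_le`).
-/

namespace Beeping.Naming

/-! ### Slot programs -/

/-- The working memory of a node in the naming phase. `total` counts the nodes named so far, as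
far as the node's group knows; `last` is the key that was named most recently in the group; `cand`
is the prefix, found so far, of the next key to be named; `label` is the node's own label. -/
structure Mem where
  total : ℕ
  last : ℕ
  cand : ℕ
  label : ℕ

/-- The instruction for one slot, common to all nodes. `win` is the window it belongs to; only
nodes of the groups `win - 1` and `win` are awake. From a node's group, key and memory, `beep`
decides whether an awake node beeps (otherwise it listens), and `upd`, given whether anybody beeps
in the slot, yields the new memory of an awake node. -/
structure Instr where
  win : ℕ
  beep : ℕ → ℕ → Mem → Bool
  upd : ℕ → ℕ → Mem → Bool → Mem

/-- Whether the members of group `g` are awake when the instruction is carried out. -/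
def Instr.awake (ins : Instr) (g : ℕ) : Bool := decide (g = ins.win ∨ g + 1 = ins.win)

/-- Group `j - 1` announces bit `b` of its total, and group `j` adds it to its own total. -/
def pass (j b : ℕ) : Instr where
  win := j
  beep g _ m := decide (g + 1 = j) && m.total.testBit b
  upd g _ m ch := if g = j then { m with total := m.total + 2 ^ b * ch.toNat } else m

/-- One step of the search for the largest key below `last` in group `j`, on bit `b`: `cand` is
the maximum of `y / 2 ^ (b + 1)` over the keys `y` below `last`, and becomes the maximum of
`y / 2 ^ b`. -/
def scan (j b : ℕ) : Instr where
  win := j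
  beep g y m := decide (g = j ∧ y < m.last ∧ y / 2 ^ b = 2 * m.cand + 1)
  upd g _ m ch := if g = j then { m with cand := 2 * m.cand + ch.toNat } else m

/-- The end of a search in group `j`: the node whose key was found takes its label. All keys are
positive, so `cand = 0` means that no node was left to be named. -/
def commit (j : ℕ) : Instr where
  win := j
  beep _ _ _ := false
  upd g y m _ :=
    if g = j then
      { total := if m.cand = 0 then m.total else m.total + 1
        last := m.cand
        cand := 0
        label := if y = m.cand then m.total + 1 else m.label }
    else m

/-- The search, bit by bit from the highest one, for the next of the keys below `2 ^ L` in group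
`j`. -/
def round (L j : ℕ) : List Instr := (List.range L).reverse.map (scan j) ++ [commit j]

/-- The window of group `j`: a `D`-bit total is received from group `j - 1`, then `R` searches are
made. -/
def window (D R L j : ℕ) : List Instr :=
  (List.range D).map (pass j) ++ (List.replicate R (round L j)).flatten

/-- The windows of all `G` groups, one after the other. -/
def program (G D R L : ℕ) : List Instr := (List.range G).flatMap (window D R L)

/-- The memory at the beginning: no key has been named, all keys being below `2 ^ L`. -/
def initMem (L : ℕ) : Mem := ⟨0, 2 ^ L, 0, 0⟩

section Exec

variable {n : ℕ} (g y : Fin n → ℕ)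

/-- The memories after all nodes, with groups `g` and keys `y`, have carried out one instruction.
-/
def exec (M : Fin n → Mem) (ins : Instr) (v : Fin n) : Mem :=
  if ins.awake (g v) then
    ins.upd (g v) (y v) (M v)
      (decide (∃ w, ins.awake (g w) = true ∧ ins.beep (g w) (y w) (M w) = true))
  else M v

/-- The memories that agree with `M` outside group `j`; inside it, everything but the label is
common. -/
def withGroup (j : ℕ) (M : Fin n → Mem) (tot ℓ p : ℕ) (lab : Fin n → ℕ) (v : Fin n) : Mem :=
  if g v = j then ⟨tot, ℓ, p, lab v⟩ else M v

/-- A total of `B` reaches group `j` modulo `2 ^ d`. If group `j - 1` is empty nobody beeps and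
zero is received, hence the hypothesis `hne`. -/
theorem foldl_pass (j : ℕ) (M : Fin n → Mem) (ℓ p B : ℕ) (lab : Fin n → ℕ)
    (hB : ∀ w, g w + 1 = j → (M w).total = B) (hne : B = 0 ∨ ∃ w, g w + 1 = j) (d : ℕ) :
    ((List.range d).map (pass j)).foldl (exec g y) (withGroup g j M 0 ℓ p lab) =
      withGroup g j M (B % 2 ^ d) ℓ p lab := by
  induction d with
  | zero => simp [Nat.mod_one]
  | succ d ih =>
    rw [List.range_succ, List.map_append, List.foldl_append, ih]
    have hch : (∃ w, (pass j d).awake (g w) = true ∧ (pass j d).beep (g w) (y w)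
        (withGroup g j M (B % 2 ^ d) ℓ p lab w) = true) ↔ B.testBit d = true := by
      constructor
      · rintro ⟨w, -, h⟩
        simp only [pass, Bool.and_eq_true, decide_eq_true_eq] at h
        have hw : g w ≠ j := by omega
        simpa [withGroup, hw, hB w h.1] using h.2
      · intro h
        rcases hne with rfl | ⟨w, hw⟩
        · simp at h
        · refine ⟨w, by simp [Instr.awake, pass, hw], ?_⟩
          have hw' : g w ≠ j := by omega
          simp [pass, hw, withGroup, hw', hB w hw, h]
    funext v
    simp only [List.map_cons, List.map_nil, List.foldl_cons, List.foldl_nil, exec, hch]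
    by_cases hv : g v = j
    · simp [Instr.awake, pass, hv, withGroup, Nat.mod_pow_succ, Nat.toNat_testBit]
    · simp [pass, hv, withGroup]

/-- The members of group `j` whose keys are below `ℓ`. -/
def below (j ℓ : ℕ) : Finset (Fin n) := Finset.univ.filter fun w => g w = j ∧ y w < ℓ

/-- A maximum of prefixes is extended by one bit: the new bit is set if some element of the set
with the maximal prefix has it set. -/
theorem sup_div_step (s : Finset (Fin n)) (b : ℕ) :
    s.sup (fun w => y w / 2 ^ b) = 2 * s.sup (fun w => y w / 2 ^ (b + 1)) +
      (decide (∃ w ∈ s, y w / 2 ^ b = 2 * s.sup (fun w => y w / 2 ^ (b + 1)) + 1)).toNat := by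
  set q := s.sup (fun w => y w / 2 ^ (b + 1)) with hq
  have key : ∀ w, y w / 2 ^ (b + 1) = y w / 2 ^ b / 2 := fun w => by
    rw [pow_succ, Nat.div_div_eq_div_mul]
  have hle : ∀ w ∈ s, y w / 2 ^ b / 2 ≤ q := fun w hw => by
    rw [← key]; exact Finset.le_sup (f := fun w => y w / 2 ^ (b + 1)) hw
  apply le_antisymm
  · refine Finset.sup_le fun w hw => ?_
    have := hle w hw
    by_cases h : ∃ w ∈ s, y w / 2 ^ b = 2 * q + 1
    · simp only [h, decide_true, Bool.toNat_true]; omega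
    · have h' : y w / 2 ^ b ≠ 2 * q + 1 := fun h' => h ⟨w, hw, h'⟩
      omega
  · by_cases h : ∃ w ∈ s, y w / 2 ^ b = 2 * q + 1
    · simp only [h, decide_true, Bool.toNat_true]
      obtain ⟨w, hw, h⟩ := h
      rw [← h]; exact Finset.le_sup (f := fun w => y w / 2 ^ b) hw
    · simp only [h, decide_false, Bool.toNat_false, add_zero]
      rcases s.eq_empty_or_nonempty with rfl | hs
      · simp [hq]
      · obtain ⟨w, hw, hwq⟩ := Finset.exists_mem_eq_sup s hs (fun w => y w / 2 ^ (b + 1))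
        rw [← hq, key] at hwq
        have := Finset.le_sup (f := fun w => y w / 2 ^ b) hw
        omega

theorem exec_scan (j b : ℕ) (M : Fin n → Mem) (tot ℓ p : ℕ) (lab : Fin n → ℕ) :
    exec g y (withGroup g j M tot ℓ p lab) (scan j b) =
      withGroup g j M tot ℓ
        (2 * p + (decide (∃ w ∈ below g y j ℓ, y w / 2 ^ b = 2 * p + 1)).toNat) lab := by
  have hch : (∃ w, (scan j b).awake (g w) = true ∧ (scan j b).beep (g w) (y w)
      (withGroup g j M tot ℓ p lab w) = true) ↔
      ∃ w ∈ below g y j ℓ, y w / 2 ^ b = 2 * p + 1 := by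
    constructor
    · rintro ⟨w, -, h⟩
      simp only [scan, decide_eq_true_eq] at h
      obtain ⟨h1, h2, h3⟩ := h
      simp only [withGroup, h1, if_true] at h2 h3
      exact ⟨w, by simp [below, h1, h2], h3⟩
    · rintro ⟨w, hw, h⟩
      simp only [below, Finset.mem_filter, Finset.mem_univ, true_and] at hw
      exact ⟨w, by simp [Instr.awake, scan, hw.1], by simp [scan, withGroup, hw.1, hw.2, h]⟩
  funext v
  simp only [exec, hch]
  by_cases hv : g v = j
  · simp [Instr.awake, scan, hv, withGroup]
  · simp [scan, hv, withGroup]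

theorem foldl_scan (j : ℕ) (M : Fin n → Mem) (tot ℓ : ℕ) (lab : Fin n → ℕ) (b : ℕ) :
    ((List.range b).reverse.map (scan j)).foldl (exec g y)
      (withGroup g j M tot ℓ ((below g y j ℓ).sup fun w => y w / 2 ^ b) lab) =
      withGroup g j M tot ℓ ((below g y j ℓ).sup y) lab := by
  induction b with
  | zero => simp
  | succ b ih =>
    rw [List.range_succ, List.reverse_append, List.reverse_singleton, List.singleton_append,
      List.map_cons, List.foldl_cons, exec_scan, ← sup_div_step, ih]

theorem foldl_round (j L : ℕ) (hL : ∀ w, y w < 2 ^ L) (M : Fin n → Mem) (tot ℓ : ℕ)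
    (lab : Fin n → ℕ) :
    (round L j).foldl (exec g y) (withGroup g j M tot ℓ 0 lab) =
      withGroup g j M (if (below g y j ℓ).sup y = 0 then tot else tot + 1)
        ((below g y j ℓ).sup y) 0
        (fun v => if y v = (below g y j ℓ).sup y then tot + 1 else lab v) := by
  have h0 : (below g y j ℓ).sup (fun w => y w / 2 ^ L) = 0 := by
    refine Nat.le_zero.1 (Finset.sup_le fun w _ => ?_)
    simp [Nat.div_eq_of_lt (hL w)]
  have h := foldl_scan g y j M tot ℓ lab L
  rw [h0] at h
  rw [round, List.foldl_append, h]
  funext v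
  simp only [List.foldl_cons, List.foldl_nil, exec]
  by_cases hv : g v = j
  · simp [Instr.awake, commit, hv, withGroup]
  · simp [commit, hv, withGroup]

/-- The number of members of group `j` whose keys are at least `ℓ`. -/
def numAbove (j ℓ : ℕ) : ℕ := (Finset.univ.filter fun w : Fin n => g w = j ∧ ℓ ≤ y w).card

/-- The invariant of the searches in a window: the total counts exactly the keys from `ℓ` upwards,
their nodes carry correct labels, and every search names one more node until none is left. -/
theorem foldl_rounds (j L : ℕ) (hL : ∀ w, y w < 2 ^ L) (hpos : ∀ w, 0 < y w)
    (hinj : Function.Injective y) (M : Fin n → Mem) (base : ℕ) (lab : Fin n → ℕ) (r : ℕ) :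
    ∃ (ℓ : ℕ) (lab' : Fin n → ℕ),
      (List.replicate r (round L j)).flatten.foldl (exec g y)
        (withGroup g j M base (2 ^ L) 0 lab) =
        withGroup g j M (base + numAbove g y j ℓ) ℓ 0 lab' ∧
      (∀ v, g v = j → ℓ ≤ y v → lab' v = base + numAbove g y j (y v)) ∧
      (ℓ = 0 ∨ r ≤ numAbove g y j ℓ) := by
  induction r with
  | zero =>
    refine ⟨2 ^ L, lab, ?_, fun v _ hv => absurd (hL v) (not_lt.2 hv), Or.inr (Nat.zero_le _)⟩
    have : numAbove g y j (2 ^ L) = 0 := by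
      simp [numAbove, Finset.filter_eq_empty_iff, hL]
    simp [this]
  | succ r ih =>
    obtain ⟨ℓ, lab', h1, h2, h3⟩ := ih
    rw [List.replicate_succ', List.flatten_append, List.foldl_append, h1, List.flatten_singleton,
      foldl_round g y j L hL]
    set p := (below g y j ℓ).sup y with hp
    refine ⟨p, fun v => if y v = p then base + numAbove g y j ℓ + 1 else lab' v, ?_⟩
    -- If nobody is left, `p = 0`; otherwise `p` is the key of a new node `u`, the only one added.
    rcases (below g y j ℓ).eq_empty_or_nonempty with he | hne
    · have hp0 : p = 0 := by rw [hp, he]; simp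
      have hall : ∀ w, g w = j → ℓ ≤ y w := by
        intro w hw
        by_contra hlt
        have : w ∈ below g y j ℓ := by simp [below, hw]; omega
        simp [he] at this
      have hcard : numAbove g y j p = numAbove g y j ℓ := by
        unfold numAbove
        congr 1
        ext w
        simp only [Finset.mem_filter, Finset.mem_univ, true_and, hp0, Nat.zero_le, and_true]
        exact ⟨fun h => ⟨h, hall w h⟩, fun h => h.1⟩
      refine ⟨by rw [hcard, if_pos hp0], fun v hv _ => ?_, Or.inl hp0⟩
      have : y v ≠ p := by rw [hp0]; exact (hpos v).ne'
      simp only [this, if_false]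
      exact h2 v hv (hall v hv)
    · obtain ⟨u, hu, hup⟩ := Finset.exists_mem_eq_sup _ hne y
      rw [← hp] at hup
      simp only [below, Finset.mem_filter, Finset.mem_univ, true_and] at hu
      have hp0 : p ≠ 0 := by rw [hup]; exact (hpos u).ne'
      have hmem : ∀ w, g w = j → (p ≤ y w ↔ w = u ∨ ℓ ≤ y w) := by
        intro w hw
        constructor
        · intro hle
          by_cases hlt : y w < ℓ
          · have : y w ≤ p := Finset.le_sup (f := y) (by simp [below, hw, hlt])
            exact Or.inl (hinj (by omega))
          · exact Or.inr (by omega)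
        · rintro (rfl | h)
          · exact hup.le
          · omega
      have hcard : numAbove g y j p = numAbove g y j ℓ + 1 := by
        unfold numAbove
        rw [← Finset.card_insert_of_notMem (a := u)]
        · congr 1
          ext w
          simp only [Finset.mem_filter, Finset.mem_univ, true_and, Finset.mem_insert]
          constructor
          · rintro ⟨hw, h⟩
            exact ((hmem w hw).1 h).imp id fun h => ⟨hw, h⟩
          · rintro (rfl | ⟨hw, h⟩)
            · exact ⟨hu.1, hup.le⟩
            · exact ⟨hw, (hmem w hw).2 (Or.inr h)⟩
        · simp only [Finset.mem_filter, Finset.mem_univ, true_and, not_and, not_le]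
          exact fun _ => hu.2
      refine ⟨by rw [hcard, if_neg hp0]; rfl, fun v hv hle => ?_, Or.inr ?_⟩
      · by_cases hvp : y v = p
        · simp only [hvp, if_true, hcard]; rfl
        · simp only [hvp, if_false]
          refine h2 v hv (((hmem v hv).1 hle).resolve_left ?_)
          rintro rfl
          exact hvp hup.symm
      · rcases h3 with rfl | h3
        · exact absurd hu.2 (Nat.not_lt_zero _)
        · omega

/-- The number of nodes in the groups before group `j`. -/
def numBefore (j : ℕ) : ℕ := (Finset.univ.filter fun w : Fin n => g w < j).card

theorem numBefore_succ (j : ℕ) : numBefore g (j + 1) = numBefore g j + numAbove g y j 0 := by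
  unfold numBefore numAbove
  rw [← Finset.card_union_of_disjoint]
  · congr 1
    ext w
    simp only [Finset.mem_filter, Finset.mem_univ, true_and, Finset.mem_union]
    omega
  · rw [Finset.disjoint_filter]
    intros
    omega

/-- The label of a node: its rank in the order by group, then by decreasing key. -/
def rank (v : Fin n) : ℕ := numBefore g (g v) + numAbove g y (g v) (y v)

/-- After the first `J` windows the groups before `J` have correct labels and totals, provided
that every group is nonempty, so that totals are handed on, and has at most `R` members. -/
theorem foldl_program {G D R L : ℕ} (hL : ∀ w, y w < 2 ^ L) (hpos : ∀ w, 0 < y w)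
    (hinj : Function.Injective y) (hD : n < 2 ^ D) (hne : ∀ j < G, ∃ w, g w = j)
    (hR : ∀ j < G, numAbove g y j 0 ≤ R) (J : ℕ) (hJ : J ≤ G) (v : Fin n) :
    (J ≤ g v → (program J D R L).foldl (exec g y) (fun _ => initMem L) v = initMem L) ∧
    (g v < J → ((program J D R L).foldl (exec g y) (fun _ => initMem L) v).total =
        numBefore g (g v + 1) ∧
      ((program J D R L).foldl (exec g y) (fun _ => initMem L) v).label = rank g y v) := by
  induction J generalizing v with
  | zero => simp [program]
  | succ J ih =>
    replace ih := fun v => ih (by omega) v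
    have hprog : program (J + 1) D R L = program J D R L ++ window D R L J := by
      simp [program, List.range_succ]
    rw [hprog, List.foldl_append]
    set M := (program J D R L).foldl (exec g y) (fun _ => initMem L) with hM
    have hMw : M = withGroup g J M 0 (2 ^ L) 0 (fun _ => 0) := by
      funext w
      by_cases hw : g w = J
      · simp [withGroup, hw, (ih w).1 hw.ge, initMem]
      · simp [withGroup, hw]
    have hle : numBefore g J ≤ n := by
      unfold numBefore
      exact (Finset.card_le_univ _).trans (by simp)
    have hpass := foldl_pass g y J M (2 ^ L) 0 (numBefore g J) (fun _ => 0)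
      (fun w hw => by rw [((ih w).2 (by omega)).1, hw])
      (by
        rcases J with _ | J
        · left; simp [numBefore]
        · right
          obtain ⟨w, hw⟩ := hne J (by omega)
          exact ⟨w, by omega⟩) D
    rw [← hMw, Nat.mod_eq_of_lt (hle.trans_lt hD)] at hpass
    obtain ⟨ℓ, lab, h1, h2, h3⟩ := foldl_rounds g y J L hL hpos hinj M (numBefore g J)
      (fun _ => 0) R
    rw [window, List.foldl_append, hpass, h1]
    have hmono : ∀ w, g w = J → ℓ ≤ y w := by
      rcases h3 with rfl | h3
      · simp
      · intro w hw
        have hsub : (Finset.univ.filter fun w : Fin n => g w = J ∧ ℓ ≤ y w) ⊆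
            (Finset.univ.filter fun w : Fin n => g w = J ∧ 0 ≤ y w) := by
          intro w; simp +contextual
        have := Finset.eq_of_subset_of_card_le hsub ((hR J (by omega)).trans h3)
        have hw' : w ∈ (Finset.univ.filter fun w : Fin n => g w = J ∧ 0 ≤ y w) := by simp [hw]
        rw [← this] at hw'
        simp at hw'
        exact hw'.2
    have hcard : numAbove g y J ℓ = numAbove g y J 0 := by
      unfold numAbove
      congr 1
      ext w
      simpa using hmono w
    refine ⟨fun hv => ?_, fun hv => ?_⟩
    · have : g v ≠ J := by omega
      simp only [withGroup, this, if_false]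
      exact (ih v).1 (by omega)
    · by_cases hvJ : g v = J
      · simp only [withGroup, hvJ, if_true, hcard]
        refine ⟨(numBefore_succ g y J).symm, ?_⟩
        rw [h2 v hvJ (hmono v hvJ), rank, hvJ]
      · simp only [withGroup, hvJ, if_false]
        exact (ih v).2 (by omega)

theorem rank_mem_Icc (v : Fin n) : rank g y v ∈ Finset.Icc 1 n := by
  have hdis : Disjoint (Finset.univ.filter fun w : Fin n => g w < g v)
      (Finset.univ.filter fun w : Fin n => g w = g v ∧ y v ≤ y w) := by
    rw [Finset.disjoint_filter]; intros; omega
  rw [Finset.mem_Icc, rank, numBefore, numAbove]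
  refine ⟨?_, ?_⟩
  · have : 0 < (Finset.univ.filter fun w : Fin n => g w = g v ∧ y v ≤ y w).card :=
      Finset.card_pos.2 ⟨v, by simp⟩
    omega
  · rw [← Finset.card_union_of_disjoint hdis]
    exact (Finset.card_le_univ _).trans (by simp)

theorem numBefore_mono {i j : ℕ} (h : i ≤ j) : numBefore g i ≤ numBefore g j := by
  refine Finset.card_le_card fun w hw => ?_
  simp only [Finset.mem_filter, Finset.mem_univ, true_and] at hw ⊢
  omega

theorem rank_lt_of_group_lt {v w : Fin n} (h : g v < g w) : rank g y v < rank g y w := by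
  have h1 : rank g y v ≤ numBefore g (g v + 1) := by
    rw [numBefore_succ g y, rank]
    refine Nat.add_le_add_left (Finset.card_le_card fun u hu => ?_) _
    simp only [Finset.mem_filter, Finset.mem_univ, true_and] at hu ⊢
    omega
  have h2 : 0 < numAbove g y (g w) (y w) := Finset.card_pos.2 ⟨w, by simp⟩
  have h3 := numBefore_mono g (Nat.succ_le_of_lt h)
  simp only [rank, Nat.succ_eq_add_one] at *
  omega

theorem rank_lt_of_key_lt {v w : Fin n} (hg : g v = g w) (h : y w < y v) :
    rank g y v < rank g y w := by
  rw [rank, rank, hg]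
  refine Nat.add_lt_add_left (Finset.card_lt_card ?_) _
  rw [Finset.ssubset_iff_of_subset]
  · exact ⟨w, by simp, by simp [h]⟩
  · intro u hu
    simp only [Finset.mem_filter, Finset.mem_univ, true_and] at hu ⊢
    omega

theorem rank_injective (hinj : Function.Injective y) : Function.Injective (rank g y) := by
  intro v w h
  rcases lt_trichotomy (g v) (g w) with hg | hg | hg
  · exact absurd h (rank_lt_of_group_lt g y hg).ne
  · rcases lt_trichotomy (y v) (y w) with hy | hy | hy
    · exact absurd h (rank_lt_of_key_lt g y hg.symm hy).ne'
    · exact hinj hy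
    · exact absurd h (rank_lt_of_key_lt g y hg hy).ne
  · exact absurd h (rank_lt_of_group_lt g y hg).ne'

end Exec

/-! ### The protocol and its executions -/

/-- The states of a node. `est i j s`: level `i` of the estimation, after `j` of its slots, `s` of
which were silent. `pick k`: the estimation has ended at level `k`, and the key is about to be
drawn. `run g y m prog`: naming phase of a node of group `g` with key `y` and memory `m`; `prog`
is still to be carried out, and the node halts when it is empty. -/
inductive NodeState where
  | est (i j s : ℕ)
  | pick (k : ℕ)
  | run (g y : ℕ) (m : Mem) (prog : List Instr)

/-- The number of groups after stopping at level `k`: a power of two, so that a uniform bit string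
reduces to a uniform group, and of order `2 ^ k / k`, so that groups have of the order of `k`
members. The factor `2048` makes it at least `64 k` in expectation whenever `2 ^ k < 32 n` and there
is more than one group. -/
def numGroups (k : ℕ) : ℕ := 2 ^ Nat.log 2 (2 ^ k / (2048 * k))

/-- The number of coins tossed for a key after stopping at level `k`: for `n < 2 ^ (k + 3)`
it exceeds `2 log₂ n` by at least `48 k`, so that two keys coincide with probability at most
`2 ^ (-48 k)`. -/
def keyBits (k : ℕ) : ℕ := 56 * k

/-- The number of searches per window, an upper bound for the sizes of the groups. They are
at most `32768 k` in expectation, and `65600 = 2 * 32768 + 64`, as Markov's inequality needs for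
a failure probability `2 ^ (-64 k)`. -/
def maxLoad (k : ℕ) : ℕ := 65600 * k

/-- The program of the naming phase after stopping at level `k`: fewer than `2 ^ (k + 3)` nodes
are expected, and keys are at most `2 ^ keyBits k`. -/
def namingProgram (k : ℕ) : List Instr :=
  program (numGroups k) (k + 3) (maxLoad k) (keyBits k + 1)

/-- The number with the given binary digits, the lowest one first. -/
def keyOf (l : List Bool) : ℕ := Nat.ofDigits 2 (l.map Bool.toNat)

/-- The transitions of the protocol. A node that beeps in a slot gets no feedback, but knows that
the slot is not silent. At the end of level `i` the estimation stops if at least half of its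
`16 i` slots were silent. -/
def nextState : NodeState → List Bool → Option Bool → NodeState
  | .est i j s, _, fb =>
    let s' := if fb = some false then s + 1 else s
    if j + 1 < 16 * i then .est i (j + 1) s'
    else if 16 * i ≤ 2 * s' then .pick i
    else .est (i + 1) 0 0
  | .pick k, l, _ =>
    .run (keyOf l % numGroups k) (keyOf l + 1) (initMem (keyBits k + 1)) (namingProgram k)
  | .run g y m [], _, _ => .run g y m []
  | .run g y m (ins :: p), _, fb =>
    -- An awake node without feedback has beeped itself.
    .run g y (if ins.awake g then ins.upd g y m (fb.getD true) else m) p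

/-- The naming protocol. In level `i` of the estimation a node beeps with probability `2 ^ (-i)`.
-/
def namingProtocol : Protocol where
  State := NodeState
  init := .est 1 0 0
  coins
    | .est i _ _ => i
    | .pick k => keyBits k
    | .run _ _ _ _ => 0
  act
    | .est _ _ _, l => if l.all id then .beep else .listen
    | .run g y m (ins :: _), _ =>
      if ins.awake g then if ins.beep g y m then .beep else .listen else .sleep
    | _, _ => .sleep
  next := nextState
  output
    | .run _ _ m [] => some m.label
    | _ => none

section Simulation

variable {n : ℕ} (ω : Outcome n)

/-- The first slot of level `i` of the estimation; the levels start with level `1`, in slot `0`.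
-/
def levelStart (i : ℕ) : ℕ := ∑ l ∈ Finset.range i, 16 * l

theorem levelStart_succ (i : ℕ) : levelStart (i + 1) = levelStart i + 16 * i :=
  Finset.sum_range_succ _ _

/-- Slot `t` is silent, provided that it belongs to level `i` of the estimation. -/
def Silent (t i : ℕ) : Prop := ∀ v : Fin n, ∃ b : Fin i, ω (v, t, b) = false

open Classical in
/-- The number of silent slots among the first `m` slots of level `i`. -/
noncomputable def silentCount (i m : ℕ) : ℕ :=
  ((Finset.range m).filter fun s => Silent ω (levelStart i + s) i).card

open Classical in
theorem silentCount_succ (i m : ℕ) : silentCount ω i (m + 1) =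
    if Silent ω (levelStart i + m) i then silentCount ω i m + 1 else silentCount ω i m := by
  unfold silentCount
  rw [Finset.range_add_one, Finset.filter_insert]
  split_ifs <;> simp

/-- The estimation, if it reaches level `i`, stops there. This event is determined by the coins
alone, whether or not level `i` is reached. -/
def Stops (i : ℕ) : Prop := 16 * i ≤ 2 * silentCount ω i (16 * i)

open Classical in
theorem step_est (t i j s : ℕ) :
    namingProtocol.step ω t (fun _ => .est i j s) = fun _ =>
      if j + 1 < 16 * i then .est i (j + 1) (if Silent ω t i then s + 1 else s)
      else if 16 * i ≤ 2 * (if Silent ω t i then s + 1 else s) then .pick i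
      else .est (i + 1) 0 0 := by
  funext v
  have hact : ∀ w : Fin n, namingProtocol.actions ω t (fun _ => .est i j s) w =
      if ∀ b : Fin i, ω (w, t, b) = true then Action.beep else Action.listen := by
    intro w
    have : ((List.ofFn fun b : Fin i => ω (w, t, b)).all id = true) ↔
        ∀ b : Fin i, ω (w, t, b) = true := by
      simp [List.all_eq_true, List.mem_ofFn]
    simp only [Protocol.actions, Protocol.toss, namingProtocol, Option.isSome_none,
      Bool.false_eq_true, if_false, ← this]
  have hfb : feedback (namingProtocol.actions ω t fun _ => .est i j s) v = some false ↔
      Silent ω t i := by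
    simp only [feedback, hact, Silent]
    constructor
    · intro h w
      by_contra hw
      push Not at hw
      by_cases hl : (if ∀ b : Fin i, ω (v, t, b) = true then Action.beep else Action.listen) =
          Action.listen
      swap
      · simp [hl] at h
      rw [if_pos hl] at h
      refine of_decide_eq_false (Option.some.inj h) ⟨w, if_pos fun b => by simpa using hw b⟩
    · intro h
      have h' : ∀ w : Fin n, ¬ ∀ b : Fin i, ω (w, t, b) = true := by
        intro w hw
        obtain ⟨b, hb⟩ := h w
        simp [hw b] at hb
      simp [h']
  change nextState (.est i j s) (namingProtocol.toss ω t v (.est i j s)) _ = _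
  simp only [nextState, hfb]
  rfl

/-- The nodes stay in one common state during the estimation, since all of them know for every
slot whether it was silent. -/
theorem config_est {i : ℕ} (h : namingProtocol.config ω (levelStart i) = fun _ => .est i 0 0)
    (j : ℕ) (hj : j < 16 * i) : namingProtocol.config ω (levelStart i + j) =
      fun _ => .est i j (silentCount ω i j) := by
  induction j with
  | zero => simpa [silentCount] using h
  | succ j ih =>
    rw [← add_assoc, Protocol.config, ih (by omega), step_est, silentCount_succ]
    exact funext fun _ => if_pos hj

open Classical in
theorem config_level_end {i : ℕ} (hi : 1 ≤ i)
    (h : namingProtocol.config ω (levelStart i) = fun _ => .est i 0 0) :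
    namingProtocol.config ω (levelStart (i + 1)) =
      fun _ => if Stops ω i then .pick i else .est (i + 1) 0 0 := by
  have h1 : levelStart (i + 1) = levelStart i + (16 * i - 1) + 1 := by
    rw [levelStart_succ]; omega
  have h2 : 16 * i - 1 + 1 = 16 * i := by omega
  rw [h1, Protocol.config, config_est ω h _ (by omega), step_est, h2, ← silentCount_succ, h2]
  exact funext fun _ => (if_neg (lt_irrefl _)).trans (if_congr Iff.rfl rfl rfl)

theorem config_levelStart {k : ℕ} (hk : ∀ i, 1 ≤ i → i < k → ¬ Stops ω i) (hk1 : 1 ≤ k) :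
    namingProtocol.config ω (levelStart k) = fun _ => .est k 0 0 := by
  induction k, hk1 using Nat.le_induction with
  | base => rfl
  | succ k hk1 ih =>
    rw [config_level_end ω hk1 (ih fun i h1 h2 => hk i h1 (by omega))]
    exact funext fun _ => if_neg (hk k hk1 (by omega))

/-- The random number drawn by node `v` when the estimation stops at level `k`. As the slot of the
draw is determined by `k`, it is a function of the coins alone. -/
def key (k : ℕ) (v : Fin n) : ℕ :=
  keyOf (List.ofFn fun i : Fin (keyBits k) => ω (v, levelStart (k + 1), i))

theorem config_pick {k : ℕ} (hk1 : 1 ≤ k) (hk : ∀ i, 1 ≤ i → i < k → ¬ Stops ω i)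
    (hs : Stops ω k) : namingProtocol.config ω (levelStart (k + 1) + 1) =
      fun v => .run (key ω k v % numGroups k) (key ω k v + 1) (initMem (keyBits k + 1))
        (namingProgram k) := by
  have h : namingProtocol.config ω (levelStart (k + 1)) = fun _ => .pick k :=
    (config_level_end ω hk1 (config_levelStart ω hk hk1)).trans (funext fun _ => if_pos hs)
  rw [Protocol.config, h]
  rfl

theorem actions_run (t : ℕ) (g y : Fin n → ℕ) (M : Fin n → Mem) (ins : Instr) (p : List Instr)
    (v : Fin n) : namingProtocol.actions ω t (fun v => .run (g v) (y v) (M v) (ins :: p)) v =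
      if ins.awake (g v) then if ins.beep (g v) (y v) (M v) then .beep else .listen
      else .sleep := rfl

theorem step_run (t : ℕ) (g y : Fin n → ℕ) (M : Fin n → Mem) (ins : Instr) (p : List Instr) :
    namingProtocol.step ω t (fun v => .run (g v) (y v) (M v) (ins :: p)) =
      fun v => .run (g v) (y v) (exec g y M ins v) p := by
  funext v
  change nextState (.run (g v) (y v) (M v) (ins :: p)) [] _ = _
  simp only [nextState, exec]
  by_cases hv : ins.awake (g v) = true
  · have hfb : (feedback (namingProtocol.actions ω t
        fun v => .run (g v) (y v) (M v) (ins :: p)) v).getD true =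
        decide (∃ w, ins.awake (g w) = true ∧ ins.beep (g w) (y w) (M w) = true) := by
      have hb : ∀ w, namingProtocol.actions ω t
          (fun v => .run (g v) (y v) (M v) (ins :: p)) w = Action.beep ↔
          ins.awake (g w) = true ∧ ins.beep (g w) (y w) (M w) = true := by
        intro w
        rw [actions_run]
        split_ifs <;> simp_all
      simp only [feedback, hb]
      rw [actions_run, if_pos hv]
      by_cases hbv : ins.beep (g v) (y v) (M v) = true
      · have : ∃ w, ins.awake (g w) = true ∧ ins.beep (g w) (y w) (M w) = true := ⟨v, hv, hbv⟩
        simp [hbv, this]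
      · simp [hbv]
    rw [hfb]
  · simp [hv]

theorem awakeSlots_succ (P : Protocol) (t : ℕ) (v : Fin n) :
    P.awakeSlots ω (t + 1) v = P.awakeSlots ω t v + if P.Awake ω v t then 1 else 0 := by
  unfold Protocol.awakeSlots
  rw [Finset.range_add_one, Finset.filter_insert]
  split_ifs <;> simp

/-- In the naming phase the nodes carry out the common program in lockstep. -/
theorem config_run (g y : Fin n → ℕ) (p : List Instr) (t : ℕ) (M : Fin n → Mem)
    (h : namingProtocol.config ω t = fun v => .run (g v) (y v) (M v) p) :
    (namingProtocol.config ω (t + p.length) =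
      fun v => .run (g v) (y v) (p.foldl (exec g y) M v) []) ∧
    ∀ v, namingProtocol.awakeSlots ω (t + p.length) v =
      namingProtocol.awakeSlots ω t v + p.countP fun ins => ins.awake (g v) := by
  induction p generalizing t M with
  | nil => exact ⟨h, fun _ => rfl⟩
  | cons ins p ih =>
    have h' : namingProtocol.config ω (t + 1) =
        fun v => .run (g v) (y v) (exec g y M ins v) p := by
      rw [Protocol.config, h, step_run]
    obtain ⟨h1, h2⟩ := ih (t + 1) _ h'
    have hlen : t + (ins :: p).length = t + 1 + p.length := by simp; omega
    rw [hlen]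
    refine ⟨h1, fun v => ?_⟩
    have haw : namingProtocol.Awake ω v t ↔ ins.awake (g v) = true := by
      unfold Protocol.Awake
      rw [h, actions_run]
      split_ifs <;> simp_all
    rw [h2 v, awakeSlots_succ, List.countP_cons]
    simp only [haw]
    omega

theorem awakeSlots_le (P : Protocol) (t : ℕ) (v : Fin n) : P.awakeSlots ω t v ≤ t :=
  (Finset.card_filter_le _ _).trans (by simp)

theorem length_window (D R L j : ℕ) : (window D R L j).length = D + R * (L + 1) := by
  simp [window, round]

theorem length_program (G D R L : ℕ) : (program G D R L).length = G * (D + R * (L + 1)) := by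
  induction G with
  | zero => simp [program]
  | succ G ih =>
    have : program (G + 1) D R L = program G D R L ++ window D R L G := by
      simp [program, List.range_succ]
    rw [this, List.length_append, ih, length_window, Nat.succ_mul]

theorem win_eq_of_mem_window {D R L j : ℕ} {ins : Instr} (h : ins ∈ window D R L j) :
    ins.win = j := by
  simp only [window, round, List.mem_append, List.mem_map, List.mem_flatten,
    List.mem_replicate] at h
  rcases h with ⟨b, -, rfl⟩ | ⟨l, ⟨-, rfl⟩, h⟩
  · rfl
  · simp only [List.mem_append, List.mem_map, List.mem_singleton] at h
    rcases h with ⟨b, -, rfl⟩ | rfl <;> rfl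

theorem countP_awake_program_le (G D R L g : ℕ) :
    (program G D R L).countP (fun ins => ins.awake g) ≤ 2 * (D + R * (L + 1)) := by
  have hwin : ∀ j, (window D R L j).countP (fun ins => ins.awake g) ≤
      if j = g ∨ j = g + 1 then D + R * (L + 1) else 0 := by
    intro j
    split_ifs with h
    · rw [← length_window D R L j]; exact List.countP_le_length
    · rw [Nat.le_zero, List.countP_eq_zero]
      intro ins hins
      have := win_eq_of_mem_window hins
      simp only [Instr.awake, decide_eq_true_eq]
      omega
  have : ∀ G, (program G D R L).countP (fun ins => ins.awake g) ≤
      (if g < G then D + R * (L + 1) else 0) + if g + 1 < G then D + R * (L + 1) else 0 := by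
    intro G
    induction G with
    | zero => simp [program]
    | succ G ih =>
      have hp : program (G + 1) D R L = program G D R L ++ window D R L G := by
        simp [program, List.range_succ]
      rw [hp, List.countP_append]
      have := hwin G
      split_ifs at * <;> omega
  refine (this G).trans ?_
  split_ifs <;> omega

/-- The keys drawn after level `k` are distinct and split the nodes into groups that are neither
empty nor too large. -/
structure GoodKeys (k : ℕ) : Prop where
  injective : Function.Injective (key ω k)
  nonempty : ∀ j < numGroups k, ∃ v, key ω k v % numGroups k = j
  load : ∀ j < numGroups k,
    (Finset.univ.filter fun v => key ω k v % numGroups k = j).card ≤ maxLoad k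

theorem keyOf_lt (l : List Bool) : keyOf l < 2 ^ l.length := by
  have h := Nat.ofDigits_lt_base_pow_length (b := 2) (l := l.map Bool.toNat) (by norm_num)
    (by
      intro x hx
      obtain ⟨b, -, rfl⟩ := List.mem_map.1 hx
      exact b.toNat_lt)
  simpa [keyOf] using h

theorem key_lt (k : ℕ) (v : Fin n) : key ω k v < 2 ^ keyBits k := by
  simpa [key] using keyOf_lt (List.ofFn fun i : Fin (keyBits k) => ω (v, levelStart (k + 1), i))

/-- The number of slots in a window of `namingProgram k`. -/
def windowLength (k : ℕ) : ℕ := k + 3 + maxLoad k * (keyBits k + 2)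

/-- The deterministic part: good coins lead to a correct naming, in bounded time and with bounded
energy. -/
theorem namedBy_of_good {k : ℕ} (hk1 : 1 ≤ k) (hk : ∀ i, 1 ≤ i → i < k → ¬ Stops ω i)
    (hs : Stops ω k) (hn : n < 2 ^ (k + 3)) (hgood : GoodKeys ω k) :
    namingProtocol.NamedBy ω (levelStart (k + 1) + 1 + numGroups k * windowLength k) ∧
      ∀ v, namingProtocol.awakeSlots ω (levelStart (k + 1) + 1 + numGroups k * windowLength k) v ≤
        levelStart (k + 1) + 1 + 2 * windowLength k := by
  set g : Fin n → ℕ := fun v => key ω k v % numGroups k with hg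
  set y : Fin n → ℕ := fun v => key ω k v + 1 with hy
  have hlen : (namingProgram k).length = numGroups k * windowLength k := length_program _ _ _ _
  obtain ⟨h1, h2⟩ := config_run ω g y _ _ _ (config_pick ω hk1 hk hs)
  rw [hlen] at h1 h2
  have hinj : Function.Injective y := fun v w h => hgood.injective (Nat.succ.inj h)
  have hG : ∀ v, g v < numGroups k := fun v => Nat.mod_lt _ (by unfold numGroups; positivity)
  have hlab : ∀ v, ((namingProgram k).foldl (exec g y)
      (fun _ => initMem (keyBits k + 1)) v).label = rank g y v := fun v =>
    ((foldl_program g y (L := keyBits k + 1)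
      (fun w => by
        have := key_lt ω k w
        have h0 : 1 ≤ 2 ^ keyBits k := Nat.one_le_two_pow
        rw [pow_succ]; simp only [hy]; omega)
      (fun w => Nat.succ_pos _) hinj hn hgood.nonempty
      (fun j hj => by simpa [numAbove] using hgood.load j hj) _ le_rfl v).2 (hG v)).2
  refine ⟨⟨rank g y, fun v => ?_, rank_mem_Icc g y, rank_injective g y hinj⟩, fun v => ?_⟩
  · rw [h1]
    simp only [namingProtocol, hlab v]
  · rw [h2 v]
    exact Nat.add_le_add (awakeSlots_le ω _ _ v) (countP_awake_program_le _ _ _ _ _)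

end Simulation

/-! ### Independent uniform families of coin tosses -/

section Uniform

variable {n : ℕ}

instance : IsProbabilityMeasure (coinMeasure n) := by unfold coinMeasure; infer_instance

theorem coinMeasure_box_le {J : Type} [Fintype J] (e : J → Fin n × ℕ × ℕ)
    (he : Function.Injective e) (b : J → Bool) :
    (coinMeasure n).real {ω | ∀ j, ω (e j) = b j} ≤ (1 / 2 : ℝ) ^ Fintype.card J := by
  classical
  have hset : {ω : Outcome n | ∀ j, ω (e j) = b j} =
      Set.pi (Finset.univ.image e : Finset _)
        (fun i => {Function.extend e b (fun _ => false) i}) := by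
    ext ω
    simp [Set.mem_pi, he.extend_apply]
  rw [hset, Measure.real, coinMeasure,
    Measure.infinitePi_pi _ (fun _ _ => measurableSet_singleton _)]
  have : ∀ i, (PMF.uniformOfFintype Bool).toMeasure
      {Function.extend e b (fun _ => false) i} = (1 / 2 : ENNReal) := by
    intro i
    rw [PMF.toMeasure_apply_singleton _ _ (measurableSet_singleton _)]
    simp
  simp [this, Finset.card_image_of_injective _ he]

/-- The `X s` behave, as far as upper bounds for probabilities go, like independent uniform random
elements of `α`. An inequality suffices here, and by summation it bounds every event. -/
def UniformFamily {ι α : Type} [Fintype ι] [Fintype α] (X : ι → Outcome n → α) : Prop :=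
  ∀ f : ι → α, (coinMeasure n).real {ω | ∀ s, X s ω = f s} ≤
    (1 / (Fintype.card α : ℝ)) ^ Fintype.card ι

theorem uniformFamily_coins {ι κ : Type} [Fintype ι] [Fintype κ] [DecidableEq κ]
    (e : ι → κ → Fin n × ℕ × ℕ)
    (he : Function.Injective fun p : ι × κ => e p.1 p.2) :
    UniformFamily fun s (ω : Outcome n) (c : κ) => ω (e s c) := by
  intro f
  have h := coinMeasure_box_le (fun p : ι × κ => e p.1 p.2) he (fun p => f p.1 p.2)
  have hset : {ω : Outcome n | ∀ s, (fun c : κ => ω (e s c)) = f s} =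
      {ω | ∀ p : ι × κ, ω (e p.1 p.2) = f p.1 p.2} := by
    ext ω
    simp [funext_iff]
  rw [hset]
  refine h.trans (le_of_eq ?_)
  simp only [Fintype.card_prod, Fintype.card_fun, Fintype.card_bool]
  push_cast
  rw [one_div, one_div, inv_pow, inv_pow, ← pow_mul, mul_comm]

variable {ι α : Type} [Fintype ι] [Fintype α] {X : ι → Outcome n → α}

theorem UniformFamily.real_le [DecidableEq ι] (hX : UniformFamily X) (F : (ι → α) → Prop)
    [DecidablePred F] :
    (coinMeasure n).real {ω | F fun s => X s ω} ≤
      ((Finset.univ.filter F).card : ℝ) * (1 / (Fintype.card α : ℝ)) ^ Fintype.card ι := by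
  have hsub : {ω | F fun s => X s ω} ⊆
      ⋃ f ∈ Finset.univ.filter F, {ω | ∀ s, X s ω = f s} := by
    intro ω hω
    simp only [Set.mem_iUnion]
    exact ⟨fun s => X s ω, by simpa using hω, fun s => rfl⟩
  calc _ ≤ _ := measureReal_mono hsub (measure_ne_top _ _)
    _ ≤ _ := measureReal_biUnion_finset_le _ _
    _ ≤ ∑ f ∈ Finset.univ.filter F, (1 / (Fintype.card α : ℝ)) ^ Fintype.card ι :=
      Finset.sum_le_sum fun f _ => hX f
    _ = _ := by simp

theorem UniformFamily.real_forall_mem_le [DecidableEq ι] [DecidableEq α]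
    (hX : UniformFamily X) (A : Finset α) :
    (coinMeasure n).real {ω | ∀ s, X s ω ∈ A} ≤
      ((A.card : ℝ) / Fintype.card α) ^ Fintype.card ι := by
  refine (hX.real_le fun f => ∀ s, f s ∈ A).trans (le_of_eq ?_)
  have : (Finset.univ.filter fun f : ι → α => ∀ s, f s ∈ A) = Fintype.piFinset fun _ => A := by
    ext f; simp
  rw [this, Fintype.card_piFinset]
  simp [div_eq_mul_inv, mul_pow]

/-- Markov's inequality for `a ^ N`, where `N` is the number of `s` with `X s ∈ A`. -/
theorem UniformFamily.real_le_card_le [DecidableEq ι] [DecidableEq α] [Nonempty α]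
    (hX : UniformFamily X) (A : Finset α) (m : ℕ) {a : ℝ} (ha : 1 ≤ a) :
    (coinMeasure n).real {ω | m ≤ (Finset.univ.filter fun s => X s ω ∈ A).card} ≤
      (1 + (a - 1) * (A.card / Fintype.card α)) ^ Fintype.card ι / a ^ m := by
  set c : (ι → α) → ℕ := fun f => (Finset.univ.filter fun s => f s ∈ A).card with hc
  refine (hX.real_le fun f => m ≤ c f).trans ?_
  have hα : (0 : ℝ) < Fintype.card α := by exact_mod_cast Fintype.card_pos
  have hsum : ∑ f : ι → α, a ^ c f =
      ((Fintype.card α : ℝ) + (a - 1) * A.card) ^ Fintype.card ι := by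
    have h1 : ∀ f : ι → α, a ^ c f = ∏ s, if f s ∈ A then a else 1 := by
      intro f
      rw [Finset.prod_ite]
      simp [hc]
    have h2 : ∑ x : α, (if x ∈ A then a else 1) = (Fintype.card α : ℝ) + (a - 1) * A.card := by
      have : ∀ x : α, (if x ∈ A then a else 1) = 1 + if x ∈ A then a - 1 else 0 := by
        intro x; split_ifs <;> ring
      simp only [this, Finset.sum_add_distrib, Finset.sum_ite_mem]
      simp only [Finset.sum_const, Finset.card_univ, nsmul_eq_mul, Finset.univ_inter]
      ring
    simp only [h1]
    rw [← h2, ← Fintype.piFinset_univ, ← Finset.prod_univ_sum (fun _ : ι => Finset.univ)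
      (fun _ x => if x ∈ A then a else 1)]
    simp
  have hmark : ((Finset.univ.filter fun f => m ≤ c f).card : ℝ) * a ^ m ≤ ∑ f : ι → α, a ^ c f := by
    rw [← nsmul_eq_mul, ← Finset.sum_const]
    calc _ ≤ ∑ f ∈ Finset.univ.filter fun f => m ≤ c f, a ^ c f :=
          Finset.sum_le_sum fun f hf => pow_le_pow_right₀ ha (Finset.mem_filter.1 hf).2
      _ ≤ _ := Finset.sum_le_sum_of_subset_of_nonneg (Finset.filter_subset _ _)
          fun f _ _ => by positivity
  rw [le_div_iff₀ (by positivity)]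
  calc _ = ((Finset.univ.filter fun f => m ≤ c f).card : ℝ) * a ^ m *
        (1 / (Fintype.card α : ℝ)) ^ Fintype.card ι := by ring
    _ ≤ ((Fintype.card α : ℝ) + (a - 1) * A.card) ^ Fintype.card ι *
        (1 / (Fintype.card α : ℝ)) ^ Fintype.card ι :=
      mul_le_mul_of_nonneg_right (hmark.trans hsum.le) (by positivity)
    _ = _ := by
      rw [← mul_pow]
      congr 1
      field_simp

end Uniform

theorem keyOf_ofFn_injective (N : ℕ) :
    Function.Injective fun f : Fin N → Bool => keyOf (List.ofFn f) := by
  intro f f' h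
  have hlt : ∀ f : Fin N → Bool, ∀ x ∈ (List.ofFn f).map Bool.toNat, x < 2 := by
    intro f x hx
    obtain ⟨b, -, rfl⟩ := List.mem_map.1 hx
    exact b.toNat_lt
  have := Nat.ofDigits_inj_of_len_eq (b := 2) (by norm_num) (by simp) (hlt f) (hlt f') h
  refine List.ofFn_injective (List.map_injective_iff.2 ?_ this)
  intro a b; cases a <;> cases b <;> simp

theorem card_keyOf_mod_eq {N e j : ℕ} (he : e ≤ N) (hj : j < 2 ^ e) :
    (Finset.univ.filter fun f : Fin N → Bool => keyOf (List.ofFn f) % 2 ^ e = j).card =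
      2 ^ (N - e) := by
  classical
  have himg : Finset.univ.image (fun f : Fin N → Bool => keyOf (List.ofFn f)) =
      Finset.range (2 ^ N) := by
    refine Finset.eq_of_subset_of_card_le ?_ ?_
    · intro x hx
      obtain ⟨f, -, rfl⟩ := Finset.mem_image.1 hx
      simpa using keyOf_lt (List.ofFn f)
    · rw [Finset.card_image_of_injective _ (keyOf_ofFn_injective N)]
      simp
  rw [← Finset.card_image_of_injective _ (keyOf_ofFn_injective N)]
  have h1 : (Finset.univ.filter fun f : Fin N → Bool => keyOf (List.ofFn f) % 2 ^ e = j).image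
      (fun f => keyOf (List.ofFn f)) = (Finset.range (2 ^ N)).filter fun x => x % 2 ^ e = j := by
    rw [← himg, Finset.filter_image]
  have h2 : (Finset.range (2 ^ N)).filter (fun x => x % 2 ^ e = j) =
      (Finset.range (2 ^ (N - e))).image fun q => j + 2 ^ e * q := by
    have hN : 2 ^ N = 2 ^ e * 2 ^ (N - e) := by rw [← pow_add]; congr 1; omega
    ext x
    simp only [Finset.mem_filter, Finset.mem_range, Finset.mem_image]
    constructor
    · rintro ⟨hx, hxj⟩
      refine ⟨x / 2 ^ e, ?_, by rw [← hxj]; exact Nat.mod_add_div _ _⟩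
      exact Nat.div_lt_of_lt_mul (hN ▸ hx)
    · rintro ⟨q, hq, rfl⟩
      refine ⟨?_, by rw [Nat.add_mul_mod_self_left, Nat.mod_eq_of_lt hj]⟩
      rw [hN]
      calc j + 2 ^ e * q < 2 ^ e + 2 ^ e * q := by omega
        _ = 2 ^ e * (q + 1) := by ring
        _ ≤ _ := Nat.mul_le_mul_left _ hq
  rw [h1, h2, Finset.card_image_of_injective, Finset.card_range]
  intro a b h
  have h0 : 0 < 2 ^ e := by positivity
  exact Nat.eq_of_mul_eq_mul_left h0 (Nat.add_left_cancel h)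

/-! ### Reliability of the estimate -/

section Estimate

variable {n : ℕ}

/-- The coins of a slot of level `i`, for all nodes, that make the slot silent. -/
def silentSet (n i : ℕ) : Finset (Fin n × Fin i → Bool) :=
  Finset.univ.filter fun b => ∀ v, ∃ c, b (v, c) = false

theorem card_silentSet_div (n i : ℕ) :
    ((silentSet n i).card : ℝ) / Fintype.card (Fin n × Fin i → Bool) = (1 - 1 / 2 ^ i) ^ n := by
  have h1 : (silentSet n i).card =
      (Fintype.piFinset fun _ : Fin n => ({fun _ => true}ᶜ : Finset (Fin i → Bool))).card := by
    refine Finset.card_equiv (Equiv.curry _ _ _) fun b => ?_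
    simp [silentSet, funext_iff]
  rw [h1, Fintype.card_piFinset]
  simp only [Finset.prod_const, Finset.card_compl, Finset.card_singleton, Fintype.card_fun,
    Fintype.card_prod, Fintype.card_bool, Fintype.card_fin, Finset.card_univ]
  rw [mul_comm n i, pow_mul]
  push_cast [Nat.one_le_two_pow]
  rw [← div_pow, sub_div, div_self (by positivity)]

/-- The coins, of all nodes, in slot number `s` of level `i`. -/
def levelCoins (i : ℕ) (s : Fin (16 * i)) (ω : Outcome n) (c : Fin n × Fin i) : Bool :=
  ω (c.1, levelStart i + s, c.2)

theorem uniformFamily_levelCoins (i : ℕ) : UniformFamily (levelCoins (n := n) i) := by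
  refine uniformFamily_coins (fun (s : Fin (16 * i)) (c : Fin n × Fin i) =>
    ((c.1, levelStart i + s, c.2) : Fin n × ℕ × ℕ)) ?_
  rintro ⟨s, v, c⟩ ⟨s', v', c'⟩ h
  simp only [Prod.mk.injEq, Nat.add_left_cancel_iff] at h
  obtain ⟨rfl, h2, h3⟩ := h
  rw [Fin.ext h2, Fin.ext h3]

theorem silentCount_eq (ω : Outcome n) (i : ℕ) : silentCount ω i (16 * i) =
    (Finset.univ.filter fun s => levelCoins i s ω ∈ silentSet n i).card := by
  classical
  unfold silentCount
  rw [← Nat.Iio_eq_range, ← Fin.map_valEmbedding_univ, Finset.filter_map, Finset.card_map]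
  congr 1
  ext s
  simp [Silent, silentSet, levelCoins]

theorem silentCount_add (ω : Outcome n) (i : ℕ) : silentCount ω i (16 * i) +
    (Finset.univ.filter fun s => levelCoins i s ω ∈ (silentSet n i)ᶜ).card = 16 * i := by
  rw [silentCount_eq]
  simp only [Finset.mem_compl]
  rw [Finset.card_filter_add_card_filter_not]
  simp

/-- Stopping far too early is unlikely: a slot is silent with probability at most `exp (-x)`,
where `x = n / 2 ^ i ≥ 8`. -/
theorem real_stops_le {i : ℕ} (hi : 1 ≤ i) (hn : 8 * 2 ^ i ≤ n) :
    (coinMeasure n).real {ω | Stops ω i} ≤ 1 / (n : ℝ) ^ 6 := by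
  set x : ℝ := n / 2 ^ i with hx
  have hx8 : 8 ≤ x := by
    rw [hx, le_div_iff₀ (by positivity)]; exact_mod_cast hn
  have hn0 : (0 : ℝ) < n := by
    have : 0 < 8 * 2 ^ i := by positivity
    exact_mod_cast this.trans_le hn
  have hsub : {ω : Outcome n | Stops ω i} ⊆ {ω | 8 * i ≤
      (Finset.univ.filter fun s => levelCoins i s ω ∈ silentSet n i).card} := by
    intro ω hω
    have : 16 * i ≤ 2 * silentCount ω i (16 * i) := hω
    rw [silentCount_eq] at this
    simp only [Set.mem_ofPred_eq]
    omega
  refine (measureReal_mono hsub (measure_ne_top _ _)).trans ?_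
  refine ((uniformFamily_levelCoins i).real_le_card_le (silentSet n i) (8 * i)
    (a := Real.exp x) (Real.one_le_exp (by linarith))).trans ?_
  rw [card_silentSet_div, Fintype.card_fin]
  have hp0 : (0 : ℝ) ≤ (1 - 1 / 2 ^ i) ^ n := by
    refine pow_nonneg (sub_nonneg.2 ?_) _
    rw [div_le_one (by positivity)]
    exact one_le_pow₀ (by norm_num)
  have hp : (1 - 1 / 2 ^ i : ℝ) ^ n ≤ Real.exp (-x) := by
    have h1 : (1 - 1 / 2 ^ i : ℝ) ≤ Real.exp (-(1 / 2 ^ i)) := Real.one_sub_le_exp_neg _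
    calc _ ≤ Real.exp (-(1 / 2 ^ i)) ^ n := by
          refine pow_le_pow_left₀ (sub_nonneg.2 ?_) h1 n
          rw [div_le_one (by positivity)]
          exact one_le_pow₀ (by norm_num)
      _ = _ := by rw [← Real.exp_nat_mul]; congr 1; rw [hx]; ring
  have hbase : 1 + (Real.exp x - 1) * (1 - 1 / 2 ^ i : ℝ) ^ n ≤ Real.exp 1 := by
    have h2 : Real.exp x * (1 - 1 / 2 ^ i : ℝ) ^ n ≤ 1 := by
      calc _ ≤ Real.exp x * Real.exp (-x) := by gcongr
        _ = 1 := by rw [← Real.exp_add]; simp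
    have h3 := Real.add_one_le_exp (1 : ℝ)
    nlinarith
  have hbase0 : 0 ≤ 1 + (Real.exp x - 1) * (1 - 1 / 2 ^ i : ℝ) ^ n := by
    have : 1 ≤ Real.exp x := Real.one_le_exp (by linarith)
    have := mul_nonneg (sub_nonneg.2 this) hp0
    linarith
  have hi' : (1 : ℝ) ≤ i := by exact_mod_cast hi
  -- `log n = log x + i log 2 ≤ (x - 1) + i ≤ i x`
  have hlog : Real.log n ≤ i * x := by
    have h1 : (n : ℝ) = x * 2 ^ i := by rw [hx]; field_simp
    rw [h1, Real.log_mul (by linarith) (by positivity), Real.log_pow]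
    have h2 := Real.log_le_sub_one_of_pos (by linarith : 0 < x)
    have h3 : Real.log 2 ≤ 1 := by linarith [Real.log_two_lt_d9]
    have h4 : (i : ℝ) * Real.log 2 ≤ i := by nlinarith
    nlinarith [mul_nonneg (sub_nonneg.2 hi') (by linarith : 0 ≤ x - 1)]
  calc _ ≤ Real.exp 1 ^ (16 * i) / Real.exp x ^ (8 * i) := by gcongr
    _ = Real.exp (16 * i - 8 * i * x) := by
      rw [← Real.exp_nat_mul, ← Real.exp_nat_mul, ← Real.exp_sub]
      congr 1
      push_cast; ring
    _ ≤ Real.exp (-(6 * Real.log n)) := by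
      refine Real.exp_le_exp.2 ?_
      nlinarith
    _ = _ := by
      rw [Real.exp_neg, one_div, show (6 : ℝ) * Real.log n = (6 : ℕ) * Real.log n by norm_num,
        Real.exp_nat_mul, Real.exp_log hn0]

/-- Passing over a level with `2 ^ i ≥ 16 n` is unlikely: its slots are not silent with
probability at most `1 / 16` each. -/
theorem real_not_stops_le {i : ℕ} (hn : 16 * n ≤ 2 ^ i) :
    (coinMeasure n).real {ω | ¬ Stops ω i} ≤ 1 / (2 ^ i) ^ 16 := by
  have hsub : {ω : Outcome n | ¬ Stops ω i} ⊆ {ω | 8 * i ≤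
      (Finset.univ.filter fun s => levelCoins i s ω ∈ (silentSet n i)ᶜ).card} := by
    intro ω hω
    have h1 : ¬ 16 * i ≤ 2 * silentCount ω i (16 * i) := hω
    have h2 := silentCount_add ω i
    simp only [Set.mem_ofPred_eq]
    omega
  refine (measureReal_mono hsub (measure_ne_top _ _)).trans ?_
  refine ((uniformFamily_levelCoins i).real_le_card_le (silentSet n i)ᶜ (8 * i)
    (a := 16) (by norm_num)).trans ?_
  have hp : ((silentSet n i)ᶜ.card : ℝ) / Fintype.card (Fin n × Fin i → Bool) ≤ 1 / 16 := by
    have h0 : (0 : ℝ) < Fintype.card (Fin n × Fin i → Bool) := by exact_mod_cast Fintype.card_pos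
    rw [Finset.card_compl, Nat.cast_sub (Finset.card_le_univ _), sub_div, div_self h0.ne',
      card_silentSet_div]
    have hle : (1 : ℝ) / 2 ^ i ≤ 1 := by
      rw [div_le_one (by positivity)]
      exact one_le_pow₀ (by norm_num)
    have hbern := one_add_mul_le_pow (a := -(1 / 2 ^ i : ℝ)) (by linarith) n
    have hsmall : (n : ℝ) * (1 / 2 ^ i) ≤ 1 / 16 := by
      rw [mul_one_div, div_le_div_iff₀ (by positivity) (by norm_num)]
      have : (16 * n : ℝ) ≤ 2 ^ i := by exact_mod_cast hn
      linarith
    rw [← sub_eq_add_neg] at hbern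
    linarith
  rw [Fintype.card_fin]
  calc _ ≤ (2 : ℝ) ^ (16 * i) / 16 ^ (8 * i) := by
        gcongr
        linarith
    _ = _ := by
      rw [show (16 : ℝ) = 2 ^ 4 by norm_num, ← pow_mul, ← pow_mul,
        div_eq_div_iff (by positivity) (by positivity), one_mul, ← pow_add]
      congr 1; ring

end Estimate

/-! ### Quality of the random keys -/

section Keys

variable {n : ℕ}

/-- The coins tossed by node `v` for its key when the estimation stops at level `k`. -/
def keyCoins (k : ℕ) (v : Fin n) (ω : Outcome n) (c : Fin (keyBits k)) : Bool :=
  ω (v, levelStart (k + 1), c)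

theorem uniformFamily_keyCoins (k : ℕ) : UniformFamily (keyCoins (n := n) k) := by
  refine uniformFamily_coins (fun (v : Fin n) (c : Fin (keyBits k)) =>
    ((v, levelStart (k + 1), c) : Fin n × ℕ × ℕ)) ?_
  rintro ⟨v, c⟩ ⟨v', c'⟩ h
  simp only [Prod.mk.injEq, true_and] at h
  obtain ⟨rfl, h2⟩ := h
  rw [Fin.ext h2]

theorem real_key_eq_le (k : ℕ) {v w : Fin n} (hvw : v ≠ w) :
    (coinMeasure n).real {ω | key ω k v = key ω k w} ≤ 1 / 2 ^ keyBits k := by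
  have hX : UniformFamily fun (b : Bool) (ω : Outcome n) (c : Fin (keyBits k)) =>
      ω (if b then v else w, levelStart (k + 1), c) := by
    refine uniformFamily_coins (fun (b : Bool) (c : Fin (keyBits k)) =>
      ((if b then v else w, levelStart (k + 1), c) : Fin n × ℕ × ℕ)) ?_
    rintro ⟨b, c⟩ ⟨b', c'⟩ h
    simp only [Prod.mk.injEq, true_and] at h
    obtain ⟨h1, h2⟩ := h
    rw [Fin.ext h2]
    cases b <;> cases b' <;> simp_all [eq_comm]
  have hsub : {ω : Outcome n | key ω k v = key ω k w} ⊆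
      {ω | keyCoins k v ω = keyCoins k w ω} := fun ω h => keyOf_ofFn_injective _ h
  refine (measureReal_mono hsub (measure_ne_top _ _)).trans ?_
  refine (hX.real_le fun f => f true = f false).trans (le_of_eq ?_)
  have hcard : (Finset.univ.filter fun f : Bool → Fin (keyBits k) → Bool =>
      f true = f false).card = 2 ^ keyBits k := by
    have himg : (Finset.univ.filter fun f : Bool → Fin (keyBits k) → Bool => f true = f false) =
        Finset.univ.image fun (a : Fin (keyBits k) → Bool) (_ : Bool) => a := by
      ext f
      simp only [Finset.mem_filter, Finset.mem_univ, true_and, Finset.mem_image]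
      constructor
      · intro h
        exact ⟨f true, by funext b; cases b <;> simp [h]⟩
      · rintro ⟨a, rfl⟩
        rfl
    rw [himg, Finset.card_image_of_injective _ fun a b h => congrFun h true]
    simp
  rw [hcard]
  simp [field]

theorem real_not_injective_le (k : ℕ) :
    (coinMeasure n).real {ω | ¬ Function.Injective (key ω k)} ≤ (n : ℝ) ^ 2 / 2 ^ keyBits k := by
  have hsub : {ω : Outcome n | ¬ Function.Injective (key ω k)} ⊆
      ⋃ p ∈ (Finset.univ : Finset (Fin n)).offDiag, {ω | key ω k p.1 = key ω k p.2} := by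
    intro ω hω
    simp only [Set.mem_ofPred_eq, Function.Injective, not_forall] at hω
    obtain ⟨v, w, h, hne⟩ := hω
    simp only [Set.mem_iUnion]
    exact ⟨(v, w), by simpa using hne, h⟩
  refine (measureReal_mono hsub (measure_ne_top _ _)).trans
    ((measureReal_biUnion_finset_le _ _).trans ?_)
  calc _ ≤ ∑ _p ∈ (Finset.univ : Finset (Fin n)).offDiag, (1 / 2 ^ keyBits k : ℝ) :=
        Finset.sum_le_sum fun p hp => real_key_eq_le k (Finset.mem_offDiag.1 hp).2.2
    _ = (Finset.univ : Finset (Fin n)).offDiag.card * (1 / 2 ^ keyBits k : ℝ) := by simp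
    _ ≤ (n : ℝ) ^ 2 * (1 / 2 ^ keyBits k) := by
      gcongr
      rw [Finset.offDiag_card]
      simp only [Finset.card_univ, Fintype.card_fin]
      exact_mod_cast (Nat.sub_le _ _).trans (by rw [sq])
    _ = _ := by ring

/-- The coin sequences that put a node into group `j`. -/
def groupSet (k j : ℕ) : Finset (Fin (keyBits k) → Bool) :=
  Finset.univ.filter fun f => keyOf (List.ofFn f) % numGroups k = j

theorem numGroups_mul_le {k : ℕ} (h : numGroups k ≠ 1) : numGroups k * (2048 * k) ≤ 2 ^ k := by
  have h0 : 2 ^ k / (2048 * k) ≠ 0 := by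
    rintro h0
    simp [numGroups, h0] at h
  exact (Nat.mul_le_mul_right _ (Nat.pow_log_le_self 2 h0)).trans (Nat.div_mul_le_self _ _)

theorem lt_numGroups_mul {k : ℕ} (hk : 1 ≤ k) : 2 ^ k < numGroups k * (4096 * k) := by
  have h1 : 2 ^ k / (2048 * k) < numGroups k * 2 := by
    rw [numGroups, ← pow_succ]
    exact Nat.lt_pow_succ_log_self (by norm_num) _
  rw [Nat.div_lt_iff_lt_mul (by omega)] at h1
  linarith

theorem numGroups_le (k : ℕ) : numGroups k ≤ 2 ^ k := by
  by_cases h : numGroups k = 1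
  · rw [h]; exact Nat.one_le_two_pow
  · have := numGroups_mul_le h
    rcases Nat.eq_zero_or_pos k with rfl | hk
    · simp [numGroups] at h
    · nlinarith

theorem card_groupSet_div {k j : ℕ} (hj : j < numGroups k) :
    ((groupSet k j).card : ℝ) / Fintype.card (Fin (keyBits k) → Bool) = 1 / numGroups k := by
  have he : Nat.log 2 (2 ^ k / (2048 * k)) ≤ keyBits k := by
    have h1 : Nat.log 2 (2 ^ k / (2048 * k)) ≤ k := by
      have := numGroups_le k
      exact (Nat.pow_le_pow_iff_right (by norm_num)).1 this
    unfold keyBits; omega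
  have := card_keyOf_mod_eq he hj
  rw [groupSet, numGroups, this]
  simp only [Fintype.card_fun, Fintype.card_bool, Fintype.card_fin]
  rw [div_eq_div_iff (by positivity) (by positivity)]
  norm_cast
  rw [← pow_add, one_mul]
  congr 1; omega

theorem mem_groupSet {k j : ℕ} {v : Fin n} {ω : Outcome n} :
    keyCoins k v ω ∈ groupSet k j ↔ key ω k v % numGroups k = j := by
  simp only [groupSet, Finset.mem_filter, Finset.mem_univ, true_and]
  rfl

/-- A group has at most `32768 k` members in expectation, so more than `65600 k` of them are
exponentially unlikely in `k`. -/
theorem real_load_le {k j : ℕ} (hk : 1 ≤ k) (hn : n < 2 ^ (k + 3)) (hj : j < numGroups k) :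
    (coinMeasure n).real {ω | maxLoad k <
      (Finset.univ.filter fun v => key ω k v % numGroups k = j).card} ≤ 1 / 2 ^ (64 * k) := by
  have hsub : {ω : Outcome n | maxLoad k <
      (Finset.univ.filter fun v => key ω k v % numGroups k = j).card} ⊆ {ω | maxLoad k ≤
      (Finset.univ.filter fun v => keyCoins k v ω ∈ groupSet k j).card} := by
    intro ω hω
    simp only [mem_groupSet]
    have : maxLoad k < _ := hω
    exact this.le
  refine (measureReal_mono hsub (measure_ne_top _ _)).trans ?_
  refine ((uniformFamily_keyCoins k).real_le_card_le (groupSet k j) (maxLoad k)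
    (a := 2) (by norm_num)).trans ?_
  rw [card_groupSet_div hj, Fintype.card_fin]
  have hG : (0 : ℝ) < numGroups k := by unfold numGroups; positivity
  have hnG : (n : ℝ) / numGroups k ≤ 32768 * k := by
    rw [div_le_iff₀ hG]
    have h1 := lt_numGroups_mul hk
    have h2 : n ≤ 32768 * k * numGroups k := by
      rw [pow_add] at hn
      linarith
    exact_mod_cast h2
  have hnum : (1 + (2 - 1) * (1 / numGroups k) : ℝ) ^ n ≤ 2 ^ (65536 * k) := by
    calc (1 + (2 - 1) * (1 / numGroups k) : ℝ) ^ n ≤ Real.exp (1 / numGroups k) ^ n := by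
          gcongr
          linarith [Real.add_one_le_exp (1 / numGroups k : ℝ)]
      _ = Real.exp (n / numGroups k) := by rw [← Real.exp_nat_mul]; congr 1; ring
      _ ≤ Real.exp ((32768 * k : ℕ) * 1) := by
          refine Real.exp_le_exp.2 ?_
          push_cast; linarith
      _ = Real.exp 1 ^ (32768 * k) := by rw [← Real.exp_nat_mul]
      _ ≤ (2 ^ 2) ^ (32768 * k) := by
          gcongr
          linarith [Real.exp_one_lt_d9]
      _ = _ := by rw [← pow_mul]; congr 1; ring
  calc _ ≤ (2 : ℝ) ^ (65536 * k) / 2 ^ maxLoad k := by gcongr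
    _ = _ := by
      rw [div_eq_div_iff (by positivity) (by positivity), one_mul, ← pow_add, maxLoad]
      congr 1; ring

/-- If there is more than one group, each has at least `64 k` members in expectation. -/
theorem real_empty_le {k j : ℕ} (hn1 : 1 ≤ n) (hn : 2 ^ k < 32 * n) (hj : j < numGroups k) :
    (coinMeasure n).real {ω | ∀ v, key ω k v % numGroups k ≠ j} ≤ 1 / 2 ^ (64 * k) := by
  have hsub : {ω : Outcome n | ∀ v, key ω k v % numGroups k ≠ j} ⊆
      {ω | ∀ v, keyCoins k v ω ∈ (groupSet k j)ᶜ} := by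
    intro ω hω v
    rw [Finset.mem_compl, mem_groupSet]
    exact hω v
  refine (measureReal_mono hsub (measure_ne_top _ _)).trans ?_
  refine ((uniformFamily_keyCoins k).real_forall_mem_le (groupSet k j)ᶜ).trans ?_
  have h0 : (0 : ℝ) < Fintype.card (Fin (keyBits k) → Bool) := by exact_mod_cast Fintype.card_pos
  rw [Finset.card_compl, Nat.cast_sub (Finset.card_le_univ _), sub_div, div_self h0.ne',
    card_groupSet_div hj, Fintype.card_fin]
  -- A single group is nonempty because `n ≥ 1`; the bound on the average load may fail for it.
  by_cases hG1 : numGroups k = 1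
  · rw [hG1]
    simp [show n ≠ 0 by omega]
  have hG : (1 : ℝ) ≤ numGroups k := by exact_mod_cast Nat.one_le_two_pow
  have hnG : (64 * k : ℝ) ≤ n / numGroups k := by
    rw [le_div_iff₀ (by linarith)]
    have h1 := numGroups_mul_le hG1
    have h2 : 64 * k * numGroups k ≤ n := by linarith
    exact_mod_cast h2
  calc (1 - 1 / numGroups k : ℝ) ^ n ≤ Real.exp (-(1 / numGroups k)) ^ n := by
        refine pow_le_pow_left₀ (sub_nonneg.2 ?_) (Real.one_sub_le_exp_neg _) n
        rw [div_le_one (by linarith)]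
        exact hG
    _ = Real.exp (-(n / numGroups k)) := by rw [← Real.exp_nat_mul]; congr 1; ring
    _ ≤ Real.exp (-((64 * k : ℕ) * 1)) := by
        refine Real.exp_le_exp.2 ?_
        push_cast; linarith
    _ = 1 / Real.exp 1 ^ (64 * k) := by rw [Real.exp_neg, Real.exp_nat_mul, one_div]
    _ ≤ _ := by
        gcongr
        linarith [Real.add_one_le_exp (1 : ℝ)]

theorem real_not_goodKeys_le {k : ℕ} (hk : 1 ≤ k) (hn1 : 1 ≤ n) (hn : n < 2 ^ (k + 3))
    (hn' : 2 ^ k < 32 * n) :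
    (coinMeasure n).real {ω | ¬ GoodKeys ω k} ≤ 3 / (n : ℝ) ^ 12 := by
  have hsub : {ω : Outcome n | ¬ GoodKeys ω k} ⊆ {ω | ¬ Function.Injective (key ω k)} ∪
      ((⋃ j ∈ Finset.range (numGroups k), {ω | ∀ v, key ω k v % numGroups k ≠ j}) ∪
      ⋃ j ∈ Finset.range (numGroups k), {ω | maxLoad k <
        (Finset.univ.filter fun v => key ω k v % numGroups k = j).card}) := by
    intro ω hω
    by_contra hc
    simp only [Set.mem_union, Set.mem_iUnion, Set.mem_ofPred_eq, Finset.mem_range, not_or,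
      not_exists, not_not, not_forall, not_lt] at hc
    obtain ⟨h1, h2, h3⟩ := hc
    exact hω ⟨h1, fun j hj => by simpa using h2 j hj, h3⟩
  have hN : (n : ℝ) ≤ 2 ^ (4 * k) := by
    have : n ≤ 2 ^ (4 * k) := hn.le.trans (Nat.pow_le_pow_right (by norm_num) (by omega))
    exact_mod_cast this
  have hn0 : (0 : ℝ) < n := by exact_mod_cast hn1
  have hbound : (1 : ℝ) / 2 ^ (48 * k) ≤ 1 / (n : ℝ) ^ 12 := by
    gcongr
    calc (n : ℝ) ^ 12 ≤ (2 ^ (4 * k)) ^ 12 := by gcongr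
      _ = _ := by rw [← pow_mul]; congr 1; ring
  have hG : (numGroups k : ℝ) ≤ 2 ^ k := by exact_mod_cast numGroups_le k
  have hGb : (numGroups k : ℝ) * (1 / 2 ^ (64 * k)) ≤ 1 / 2 ^ (48 * k) := by
    calc _ ≤ (2 : ℝ) ^ k * (1 / 2 ^ (64 * k)) := by gcongr
      _ ≤ (2 : ℝ) ^ (16 * k) * (1 / 2 ^ (64 * k)) := by
        gcongr
        · norm_num
        · omega
      _ = _ := by
        rw [mul_one_div, div_eq_div_iff (by positivity) (by positivity), one_mul, ← pow_add]
        congr 1; ring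
  have hinj : (n : ℝ) ^ 2 / 2 ^ keyBits k ≤ 1 / 2 ^ (48 * k) := by
    calc _ ≤ ((2 : ℝ) ^ (4 * k)) ^ 2 / 2 ^ keyBits k := by gcongr
      _ = _ := by
        rw [div_eq_div_iff (by positivity) (by positivity), one_mul, ← pow_mul, ← pow_add,
          keyBits]
        congr 1; ring
  have h1 := (real_not_injective_le (n := n) k).trans hinj
  have h2 : (coinMeasure n).real (⋃ j ∈ Finset.range (numGroups k),
      {ω | ∀ v, key ω k v % numGroups k ≠ j}) ≤ 1 / 2 ^ (48 * k) := by
    refine (measureReal_biUnion_finset_le _ _).trans (le_trans ?_ hGb)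
    calc _ ≤ ∑ _j ∈ Finset.range (numGroups k), (1 / 2 ^ (64 * k) : ℝ) :=
          Finset.sum_le_sum fun j hj => real_empty_le hn1 hn' (Finset.mem_range.1 hj)
      _ = _ := by simp
  have h3 : (coinMeasure n).real (⋃ j ∈ Finset.range (numGroups k), {ω | maxLoad k <
        (Finset.univ.filter fun v => key ω k v % numGroups k = j).card}) ≤ 1 / 2 ^ (48 * k) := by
    refine (measureReal_biUnion_finset_le _ _).trans (le_trans ?_ hGb)
    calc _ ≤ ∑ _j ∈ Finset.range (numGroups k), (1 / 2 ^ (64 * k) : ℝ) :=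
          Finset.sum_le_sum fun j hj => real_load_le hk hn (Finset.mem_range.1 hj)
      _ = _ := by simp
  refine (measureReal_mono hsub (measure_ne_top _ _)).trans ((measureReal_union_le _ _).trans ?_)
  have h4 := measureReal_union_le (μ := coinMeasure n) (⋃ j ∈ Finset.range (numGroups k),
      {ω : Outcome n | ∀ v, key ω k v % numGroups k ≠ j})
      (⋃ j ∈ Finset.range (numGroups k), {ω | maxLoad k <
        (Finset.univ.filter fun v => key ω k v % numGroups k = j).card})
  have h5 : 3 / (n : ℝ) ^ 12 = 3 * (1 / (n : ℝ) ^ 12) := by ring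
  linarith

end Keys

/-! ### Running time, energy and the failure probability -/

theorem levelStart_succ_eq (k : ℕ) : levelStart (k + 1) = 8 * k * (k + 1) := by
  induction k with
  | zero => simp [levelStart]
  | succ k ih => rw [levelStart_succ, ih]; ring

theorem windowLength_le {k : ℕ} (hk : 1 ≤ k) : windowLength k ≤ 4000000 * k ^ 2 := by
  unfold windowLength maxLoad keyBits
  nlinarith

theorem awake_bound {k : ℕ} (hk : 1 ≤ k) :
    levelStart (k + 1) + 1 + 2 * windowLength k ≤ 9000000 * k ^ 2 := by
  have := windowLength_le hk
  rw [levelStart_succ_eq]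
  nlinarith

theorem time_bound {k : ℕ} (hk : 1 ≤ k) :
    levelStart (k + 1) + 1 + numGroups k * windowLength k ≤ 5000000 * (2 ^ k * k) := by
  have hk2 : k ≤ 2 ^ k := Nat.lt_two_pow_self.le
  have hG : numGroups k * k ≤ 2 ^ k := by
    by_cases h : numGroups k = 1
    · rw [h, one_mul]; exact hk2
    · refine le_trans (Nat.mul_le_mul_left _ ?_) (numGroups_mul_le h)
      omega
  have h1 : numGroups k * windowLength k ≤ 4000000 * (2 ^ k * k) := by
    calc _ ≤ numGroups k * (4000000 * k ^ 2) := Nat.mul_le_mul_left _ (windowLength_le hk)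
      _ = 4000000 * (numGroups k * k * k) := by ring
      _ ≤ _ := by gcongr
  have h2 : k * k ≤ 2 ^ k * k := Nat.mul_le_mul_right _ hk2
  rw [levelStart_succ_eq]
  nlinarith

theorem le_nine_mul_log {n k : ℕ} (hn : 2 ≤ n) (hk : 2 ^ k < 32 * n) :
    (k : ℝ) ≤ 9 * Real.log n := by
  have hn' : (2 : ℝ) ≤ n := by exact_mod_cast hn
  have h1 : (2 : ℝ) ^ k ≤ (n : ℝ) ^ 6 := by
    have : (2 : ℝ) ^ k ≤ 32 * n := by exact_mod_cast hk.le
    calc _ ≤ _ := this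
      _ = 2 ^ 5 * n := by norm_num
      _ ≤ (n : ℝ) ^ 5 * n := by gcongr
      _ = _ := by ring
  have h2 := Real.log_le_log (by positivity) h1
  rw [Real.log_pow, Real.log_pow] at h2
  push_cast at h2
  have h3 := Real.log_two_gt_d9
  have h4 : (0 : ℝ) ≤ k := k.cast_nonneg
  nlinarith

variable {n : ℕ}

/-- The failure event: the estimation stops at a level `i` with `8 * 2 ^ i ≤ n`, or it does not
stop at `i₀`, or the keys drawn after some plausible level are not good. The parts refer to fixed
levels and not to the level where the protocol stops, so that no conditioning is needed in the
union bound. -/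
def Bad (n i₀ : ℕ) : Set (Outcome n) :=
  ((⋃ i ∈ (Finset.range n).filter fun i => 1 ≤ i ∧ 8 * 2 ^ i ≤ n, {ω | Stops ω i}) ∪
    {ω | ¬ Stops ω i₀}) ∪
    ⋃ k ∈ (Finset.range (32 * n)).filter fun k => 1 ≤ k ∧ n < 2 ^ (k + 3) ∧ 2 ^ k < 32 * n,
      {ω | ¬ GoodKeys ω k}

theorem real_bad_le {i₀ : ℕ} (hn : 2 ≤ n) (hi : 16 * n ≤ 2 ^ i₀) :
    (coinMeasure n).real (Bad n i₀) ≤ 1 / n := by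
  have hn' : (2 : ℝ) ≤ n := by exact_mod_cast hn
  have hn0 : (0 : ℝ) < n := by linarith
  have h1 : (coinMeasure n).real (⋃ i ∈ (Finset.range n).filter fun i => 1 ≤ i ∧ 8 * 2 ^ i ≤ n,
      {ω | Stops ω i}) ≤ n * (1 / (n : ℝ) ^ 6) := by
    refine (measureReal_biUnion_finset_le _ _).trans ?_
    calc _ ≤ ∑ _i ∈ (Finset.range n).filter fun i => 1 ≤ i ∧ 8 * 2 ^ i ≤ n, (1 / (n : ℝ) ^ 6) :=
          Finset.sum_le_sum fun i hi => by
            have := (Finset.mem_filter.1 hi).2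
            exact real_stops_le this.1 this.2
      _ ≤ _ := by
        rw [Finset.sum_const, nsmul_eq_mul]
        gcongr
        exact (Finset.card_filter_le _ _).trans (by simp)
  have h2 : (coinMeasure n).real {ω | ¬ Stops ω i₀} ≤ 1 / (n : ℝ) ^ 16 := by
    refine (real_not_stops_le hi).trans ?_
    gcongr
    have : n ≤ 2 ^ i₀ := by omega
    exact_mod_cast this
  have h3 : (coinMeasure n).real (⋃ k ∈ (Finset.range (32 * n)).filter
      fun k => 1 ≤ k ∧ n < 2 ^ (k + 3) ∧ 2 ^ k < 32 * n, {ω | ¬ GoodKeys ω k}) ≤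
      32 * n * (3 / (n : ℝ) ^ 12) := by
    refine (measureReal_biUnion_finset_le _ _).trans ?_
    calc _ ≤ ∑ _k ∈ (Finset.range (32 * n)).filter
          fun k => 1 ≤ k ∧ n < 2 ^ (k + 3) ∧ 2 ^ k < 32 * n, (3 / (n : ℝ) ^ 12) :=
          Finset.sum_le_sum fun k hk => by
            have := (Finset.mem_filter.1 hk).2
            exact real_not_goodKeys_le this.1 (by omega) this.2.1 this.2.2
      _ ≤ _ := by
        rw [Finset.sum_const, nsmul_eq_mul]
        gcongr
        have : ((Finset.range (32 * n)).filter
          fun k => 1 ≤ k ∧ n < 2 ^ (k + 3) ∧ 2 ^ k < 32 * n).card ≤ 32 * n :=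
          (Finset.card_filter_le _ _).trans (by simp)
        exact_mod_cast this
  have e1 : n * (1 / (n : ℝ) ^ 6) ≤ 1 / 16 * (1 / (n : ℝ)) := by
    have : (2 : ℝ) ^ 4 ≤ (n : ℝ) ^ 4 := by gcongr
    calc n * (1 / (n : ℝ) ^ 6) = 1 / (n : ℝ) ^ 4 * (1 / (n : ℝ)) := by field_simp
      _ ≤ (1 : ℝ) / 2 ^ 4 * (1 / (n : ℝ)) := by gcongr
      _ = _ := by norm_num
  have e2 : 1 / (n : ℝ) ^ 16 ≤ 1 / 16 * (1 / (n : ℝ)) := by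
    calc 1 / (n : ℝ) ^ 16 = 1 / (n : ℝ) ^ 15 * (1 / (n : ℝ)) := by field_simp
      _ ≤ (1 : ℝ) / 2 ^ 15 * (1 / (n : ℝ)) := by gcongr
      _ ≤ _ := by gcongr; norm_num
  have e3 : 32 * n * (3 / (n : ℝ) ^ 12) ≤ 1 / 2 * (1 / (n : ℝ)) := by
    calc 32 * n * (3 / (n : ℝ) ^ 12) = 96 * (1 / (n : ℝ) ^ 10) * (1 / (n : ℝ)) := by
          field_simp; ring
      _ ≤ 96 * (1 / 2 ^ 10) * (1 / (n : ℝ)) := by gcongr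
      _ ≤ _ := by gcongr; norm_num
  have hpos : 0 < 1 / (n : ℝ) := by positivity
  refine (measureReal_union_le _ _).trans ?_
  refine (add_le_add_left (measureReal_union_le _ _) _).trans ?_
  linarith

theorem exists_good_level {i₀ : ℕ} (hn : 2 ≤ n) (hi : 16 * n ≤ 2 ^ i₀) (hi' : 2 ^ i₀ < 32 * n)
    {ω : Outcome n} (hω : ω ∉ Bad n i₀) :
    ∃ k, 1 ≤ k ∧ (∀ i, 1 ≤ i → i < k → ¬ Stops ω i) ∧ Stops ω k ∧ n < 2 ^ (k + 3) ∧
      2 ^ k < 32 * n ∧ GoodKeys ω k := by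
  classical
  simp only [Bad, Set.mem_union, Set.mem_iUnion, Set.mem_ofPred_eq, Finset.mem_filter,
    Finset.mem_range, not_or, not_exists, not_not] at hω
  obtain ⟨⟨h1, h2⟩, h3⟩ := hω
  have hi1 : 1 ≤ i₀ := by
    rcases Nat.eq_zero_or_pos i₀ with rfl | h
    · simp at hi; omega
    · exact h
  have hex : ∃ k, 1 ≤ k ∧ Stops ω k := ⟨i₀, hi1, h2⟩
  obtain ⟨hk1, hks⟩ := Nat.find_spec hex
  -- `k` is the level at which the protocol stops.
  set k := Nat.find hex with hk
  have hle : 2 ^ k < 32 * n :=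
    (Nat.pow_le_pow_right (by norm_num) (Nat.find_min' hex ⟨hi1, h2⟩)).trans_lt hi'
  have hnk : n < 2 ^ (k + 3) := by
    by_contra hc
    have h8 : 8 * 2 ^ k ≤ n := by rw [pow_add] at hc; omega
    have := (Nat.lt_two_pow_self (n := k))
    exact h1 k ⟨by omega, hk1, h8⟩ hks
  refine ⟨k, hk1, fun i hi hik hs => Nat.find_min hex hik ⟨hi, hs⟩, hks, hnk, hle, ?_⟩
  exact h3 k ⟨Nat.lt_two_pow_self.trans hle, hk1, hnk, hle⟩

end Beeping.Naming

open Beeping.Naming in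
theorem mainTheorem1 :
    ∃ (P : Beeping.Protocol) (C c : ℝ), 0 < C ∧ 0 < c ∧
      ∀ n : ℕ, 1 ≤ n →
        1 - 1 / (n : ℝ) ^ c ≤
          (Beeping.coinMeasure n).real
            {ω | ∃ T : ℕ, (T : ℝ) ≤ C * (n * Real.log n) ∧ P.NamedBy ω T ∧
              ∀ v : Fin n, (P.awakeSlots ω T v : ℝ) ≤ C * Real.log n ^ 2} := by
  refine ⟨namingProtocol, 2000000000, 1, by norm_num, by norm_num, fun n hn1 => ?_⟩
  rw [Real.rpow_one]
  set S := {ω : Beeping.Outcome n | ∃ T : ℕ, (T : ℝ) ≤ 2000000000 * (n * Real.log n) ∧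
    namingProtocol.NamedBy ω T ∧
    ∀ v : Fin n, (namingProtocol.awakeSlots ω T v : ℝ) ≤ 2000000000 * Real.log n ^ 2}
  -- For `n = 1` the claimed probability is `0`.
  rcases hn1.eq_or_lt with rfl | hn
  · simp
  obtain ⟨i₀, hi, hi'⟩ : ∃ i₀, 16 * n ≤ 2 ^ i₀ ∧ 2 ^ i₀ < 32 * n := by
    refine ⟨Nat.clog 2 (16 * n), Nat.le_pow_clog (by norm_num) _, ?_⟩
    have h1 := Nat.pow_pred_clog_lt_self (b := 2) (by norm_num) (x := 16 * n) (by omega)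
    have h2 : 0 < Nat.clog 2 (16 * n) := Nat.clog_pos (by norm_num) (by omega)
    have h3 : 2 ^ Nat.clog 2 (16 * n) = 2 * 2 ^ (Nat.clog 2 (16 * n)).pred := by
      rw [← pow_succ']; congr 1; exact (Nat.succ_pred_eq_of_pos h2).symm
    omega
  have hlog : 0 ≤ Real.log n := Real.log_natCast_nonneg n
  have hgood : (Bad n i₀)ᶜ ⊆ S := by
    intro ω hω
    obtain ⟨k, hk1, hk, hs, hnk, hkn, hg⟩ := exists_good_level hn hi hi' hω
    obtain ⟨hnamed, hawake⟩ := namedBy_of_good ω hk1 hk hs hnk hg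
    have hklog := le_nine_mul_log hn hkn
    refine ⟨_, ?_, hnamed, fun v => ?_⟩
    · have h1 : ((levelStart (k + 1) + 1 + numGroups k * windowLength k : ℕ) : ℝ) ≤
          (5000000 * (2 ^ k * k) : ℕ) := Nat.cast_le.2 (time_bound hk1)
      have h2 : (2 : ℝ) ^ k ≤ 32 * n := by exact_mod_cast hkn.le
      calc _ ≤ _ := h1
        _ = 5000000 * ((2 : ℝ) ^ k * k) := by push_cast; ring
        _ ≤ 5000000 * ((32 * n) * (9 * Real.log n)) := by gcongr
        _ = 1440000000 * (n * Real.log n) := by ring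
        _ ≤ _ := by gcongr; norm_num
    · have h1 : (namingProtocol.awakeSlots ω
          (levelStart (k + 1) + 1 + numGroups k * windowLength k) v : ℝ) ≤
          (9000000 * k ^ 2 : ℕ) := Nat.cast_le.2 ((hawake v).trans (awake_bound hk1))
      calc _ ≤ _ := h1
        _ = 9000000 * (k : ℝ) ^ 2 := by push_cast; ring
        _ ≤ 9000000 * (9 * Real.log n) ^ 2 := by gcongr
        _ = 729000000 * Real.log n ^ 2 := by ring
        _ ≤ _ := by gcongr; norm_num
  -- Subadditivity on `Bad ∪ S`, the whole space, needs no measurability.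
  have hbad := real_bad_le hn hi
  have huniv : (1 : ℝ) ≤ (Beeping.coinMeasure n).real (Bad n i₀) +
      (Beeping.coinMeasure n).real S := by
    calc (1 : ℝ) = (Beeping.coinMeasure n).real Set.univ := by simp
      _ ≤ (Beeping.coinMeasure n).real (Bad n i₀ ∪ S) := by
        refine measureReal_mono (fun ω _ => ?_) (measure_ne_top _ _)
        by_cases h : ω ∈ Bad n i₀
        · exact Or.inl h
        · exact Or.inr (hgood h)
      _ ≤ _ := measureReal_union_le _ _
  linarith
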